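/- Let $\mathbb{F}_q$ be a finite field, let $F=\mathbb{F}_q(x)$ be the rational function field, and let $m$ be a positive integer such that $\mathbb{F}_q$ contains a primitive $m$-th root of unity $\omega_m$ (so $\gcd(m,q)=1$). Let $u(x)\in\mathbb{F}_q[x]$ be a square-free polynomial whose degree $d=\deg u$ is relatively prime to $m$, and let $E=F(y)$ with $y^m=u(x)$. For a place $P$ of a function field over $\mathbb{F}_q$ let $\nu_P$ be its normalized discrete valuation (trivial on $\mathbb{F}_q^*$), $\mathcal{O}_P=\{z:\nu_P(z)\ge 0\}$ its valuation ring, and $\deg P$ the degree over $\mathbb{F}_q$ of its residue class field; $P$ is rational if $\deg P=1$. A place $P$ of $E$ lies above a place $Q$ of $F$ if $\mathcal{O}_P\cap F=\mathcal{O}_Q$. Then: (i) The extension $E/F$ is Galois of degree $[E:F]=m$, and its Galois group is isomorphic to the cyclic group $\langle\omega_m\rangle$; more precisely, there is an isomorphism $\phi:\mathrm{Gal}(E/F)\to\langle\omega_m\rangle$ with $\sigma(y)=\phi(\sigma)\,y$ for every $\sigma\in\mathrm{Gal}(E/F)$. (ii) $x$ has a unique pole $Q_\infty$ among the places of $F$;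 it is rational and totally ramified in $E/F$, that is, there is exactly one place $P_\infty$ of $E$ above $Q_\infty$, and its ramification index is $[E:F]$. Moreover $\nu_{P_\infty}(x)=-m$ and $\nu_{P_\infty}(y)=-d$. (iii) For every place $Q\neq Q_\infty$ of $F$, $\{1,y,\dots,y^{m-1}\}$ is an integral basis of $E/F$ at $Q$, that is, a basis of the integral closure of $\mathcal{O}_Q$ in $E$ as an $\mathcal{O}_Q$-module. (iv) If $Q$ is a rational place of $F$ such that $u(Q)=\alpha^m$ for some $\alpha\in\mathbb{F}_q^*$ (that is, $u\in\mathcal{O}_Q$ and its residue class at $Q$ is $\alpha^m$), then $Q$ splits completely in $E/F$, that is, there are exactly $[E:F]$ places of $E$ above $Q$. -/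

import Mathlib

open scoped WithZero

noncomputable section

/-- A place of a function field `K / k`, given by its normalized discrete valuation
(written multiplicatively, with values in `ℤᵐ⁰ = {0} ∪ {exp n | n ∈ ℤ}`): it is onto `ℤᵐ⁰` and
trivial on the nonzero constants.  By normalization, a place is determined by its ring `𝒪_P`. -/
@[ext]
structure Place (k K : Type*) [Field k] [Field K] [Algebra k K] where
  /-- the multiplicative valuation, `val z = exp (-ν_P(z))` -/
  val : Valuation K ℤᵐ⁰
  surjective_val : Function.Surjective val
  val_algebraMap : ∀ a : k, a ≠ 0 → val (algebraMap k K a) = 1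

namespace Place

section Basic

variable {k K : Type*} [Field k] [Field K] [Algebra k K]

open Classical in
/-- The discrete valuation `ν_P : K → ℤ ∪ {∞}` of a place. -/
def ord (P : Place k K) (z : K) : WithTop ℤ :=
  if z = 0 then ⊤ else ((-(WithZero.log (P.val z)) : ℤ) : WithTop ℤ)

/-- The valuation ring `𝒪_P` of a place. -/
abbrev integers (P : Place k K) : ValuationSubring K := P.val.valuationSubring

theorem mem_integers_iff (P : Place k K) (z : K) : z ∈ P.integers ↔ 0 ≤ P.ord z := by
  rw [Valuation.mem_valuationSubring_iff, ord]
  split_ifs with h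
  · simp [h]
  · have h0 : P.val z ≠ 0 := (Valuation.ne_zero_iff _).2 h
    rw [← WithTop.coe_zero, WithTop.coe_le_coe, Left.nonneg_neg_iff, ← WithZero.log_one,
      WithZero.log_le_log h0 one_ne_zero]

theorem algebraMap_mem (P : Place k K) (a : k) : algebraMap k K a ∈ P.integers := by
  rw [Valuation.mem_valuationSubring_iff]
  by_cases h : a = 0
  · simp [h]
  · exact (P.val_algebraMap a h).le

/-- The residue class field `𝒪_P / P`. -/
abbrev residueField (P : Place k K) : Type _ := IsLocalRing.ResidueField P.integers

/-- The embedding of the constants `k → 𝒪_P → 𝒪_P / P`. -/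
def constEmbedding (P : Place k K) : k →+* P.residueField :=
  (IsLocalRing.residue P.integers).comp
    ((algebraMap k K).codRestrict P.integers P.algebraMap_mem)

/-- The degree of a place: the degree of its residue class field over the constants. -/
def degree (P : Place k K) : ℕ :=
  letI : Algebra k P.residueField := P.constEmbedding.toAlgebra
  Module.finrank k P.residueField

/-- A rational place is a place of degree one. -/
def IsRational (P : Place k K) : Prop := P.degree = 1

/-- `f(P) = a`: the function `f` is regular at `P` and its residue class at `P` is
the constant `a`. -/
def EvalEq (P : Place k K) (f : K) (a : k) : Prop :=
  ∃ h : f ∈ P.integers,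
    IsLocalRing.residue P.integers ⟨f, h⟩ = P.constEmbedding a

/-- `P` is a pole of `f`. -/
def IsPole (P : Place k K) (f : K) : Prop := P.ord f < 0

end Basic

section Extension

variable {k F E : Type*} [Field k] [Field F] [Field E] [Algebra k F] [Algebra k E] [Algebra F E]

/-- The place `P` of `E` lies above the place `Q` of `F`: `𝒪_P ∩ F = 𝒪_Q`. -/
def LiesAbove (P : Place k E) (Q : Place k F) : Prop :=
  P.integers.comap (algebraMap F E) = Q.integers

/-- `P` lies above `Q` with ramification index `e`: `ν_P(z) = e · ν_Q(z)` for all `z ∈ F`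
(the case `z = 0` forces `e ≥ 1`). -/
def HasRamificationIndex (P : Place k E) (Q : Place k F) (e : ℕ) : Prop :=
  P.LiesAbove Q ∧ ∀ z : F, P.val (algebraMap F E z) = Q.val z ^ e

variable (E) in
/-- `Q` splits completely in `E / F`: there are exactly `[E : F]` places of `E` above `Q`. -/
def SplitsCompletely (Q : Place k F) : Prop :=
  {P : Place k E | P.LiesAbove Q}.encard = (Module.finrank F E : ℕ∞)

/-- The family `z` is an integral basis of `E / F` at `Q`: it is a basis of the integral closure
of `𝒪_Q` in `E` as an `𝒪_Q`-module. -/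
def IsIntegralBasis (Q : Place k F) {ι : Type*} (z : ι → E) : Prop :=
  LinearIndependent Q.integers z ∧
    Submodule.span Q.integers (Set.range z) =
      Subalgebra.toSubmodule (integralClosure Q.integers E)

end Extension

end Place

end

/-!
The norm of `y` satisfies `N(y) ^ m = u ^ [E : F]`; since `ν_∞(u) = -d` is prime to `m`, this forces
`[E : F] = m`, so that Kummer theory applies, and every `z ∈ E` is uniquely `∑ cᵢ yⁱ` with `i < m`.

* At a place above `Q_∞` the terms `cᵢ yⁱ` have pairwise distinct valuations, because
  `m ν(cᵢ yⁱ) = e (m ν_∞(cᵢ) - i d)` and the right-hand factors differ modulo `m`. The valuation of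
  `z` is the least of these, so it is determined by the `cᵢ`: the place is unique, and its
  ramification index is `m`.
* At `Q ≠ Q_∞`, averaging the conjugates of an integral `z` against a character of the Galois group
  shows that each `cᵢ yⁱ` is integral. Its `m`-th power is `cᵢ ^ m * u ^ i` with `0 ≤ ν_Q(u) ≤ 1`,
  `u` being square-free, and `i < m` gives `ν_Q(cᵢ) ≥ 0`.
* If `u(Q) = α ^ m`, then `y ^ m - α ^ m = ∏ (y - ζ α)` shows that `y` takes at each place above `Q`
  a value `β` with `β ^ m = α ^ m`. By the integral basis `β` determines the place, and the Galois
  group permutes the values transitively, so there are exactly `m` places above `Q`.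
-/

section Valuation

open IsDedekindDomain

variable {K : Type*} [Field K]

theorem lt_one_iff_le_exp_neg_one {x : ℤᵐ⁰} : x < 1 ↔ x ≤ WithZero.exp (-1) := by
  rcases eq_or_ne x 0 with rfl | hx
  · simp
  · rw [← WithZero.exp_log hx, ← WithZero.exp_zero, WithZero.exp_lt_exp, WithZero.exp_le_exp]
    omega

theorem le_one_of_pow_mul_pow_le_one {m i : ℕ} (hi : i < m) {x b : ℤᵐ⁰}
    (hb : WithZero.exp (-1) ≤ b) (h : x ^ m * b ^ i ≤ 1) : x ≤ 1 := by
  by_contra! hx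
  have hx0 : x ≠ 0 := (zero_lt_one.trans hx).ne'
  have hb0 : b ≠ 0 := (WithZero.exp_pos.trans_le hb).ne'
  have hlog : m * WithZero.log x + i * WithZero.log b ≤ 0 := by
    rw [← WithZero.log_one]
    simpa [WithZero.log_mul, hx0, hb0] using
      (WithZero.log_le_log (mul_ne_zero (pow_ne_zero m hx0) (pow_ne_zero i hb0)) one_ne_zero).2 h
  have hlogx : 0 + 1 ≤ WithZero.log x :=
    Int.add_one_le_iff.2 (by simpa using (WithZero.log_lt_log one_ne_zero hx0).2 hx)
  have hlogb : -1 ≤ WithZero.log b := by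
    simpa using (WithZero.log_le_log WithZero.exp_ne_zero hb0).2 hb
  nlinarith [Int.natCast_nonneg i, Int.ofNat_lt.2 hi]

theorem valuation_sub_lt_one_iff {R Γ : Type*} [Ring R] [LinearOrderedCommGroupWithZero Γ]
    {v : Valuation R Γ} {f g : R} (hfg : v (f - g) < 1) : v f < 1 ↔ v g < 1 :=
  ⟨fun hf => by simpa using v.map_sub_lt hf hfg, fun hg => by simpa using v.map_add_lt hfg hg⟩

theorem exists_valuation_sum_eq {R Γ ι : Type*} [Ring R] [LinearOrderedCommGroupWithZero Γ]
    [Fintype ι] [Nonempty ι] (v : Valuation R Γ) (f : ι → R)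
    (hf : ∀ i j, v (f i) ≠ 0 → v (f i) = v (f j) → i = j) :
    ∃ i, v (∑ i, f i) = v (f i) ∧ ∀ j, v (f j) ≤ v (f i) := by
  classical
  obtain ⟨i, hi⟩ := Finite.exists_max fun i => v (f i)
  refine ⟨i, ?_, hi⟩
  rcases eq_or_ne (v (f i)) 0 with h0 | h0
  · rw [h0]
    exact le_antisymm (v.map_sum_le fun j _ => h0 ▸ hi j) zero_le
  · refine v.map_sum_eq_of_lt (Finset.mem_univ i) fun j hj => lt_of_le_of_ne (hi j) fun h => ?_
    exact (Finset.mem_sdiff.1 hj).2 (Finset.mem_singleton.2 (hf i j h0 h.symm).symm)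

variable {v w : Valuation K ℤᵐ⁰}

theorem exists_valuation_eq_pow_of_forall_le_one (hv : Function.Surjective v)
    (h : ∀ z, v z ≤ 1 → w z ≤ 1) : ∃ e : ℕ, ∀ z ≠ 0, w z = v z ^ e := by
  obtain ⟨t, ht⟩ := hv (WithZero.exp (-1))
  have ht0 : t ≠ 0 := v.ne_zero_iff.1 (ht ▸ WithZero.exp_ne_zero)
  have hwt : WithZero.log (w t) ≤ 0 := by
    have := h t (ht ▸ (lt_one_iff_le_exp_neg_one.2 le_rfl).le)
    simpa using (WithZero.log_le_log (w.ne_zero_iff.2 ht0) one_ne_zero).2 this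
  have hunit : ∀ z, v z = 1 → w z = 1 := fun z hz => by
    have hz0 : z ≠ 0 := by rintro rfl; simp at hz
    refine le_antisymm (h z hz.le) ((inv_le_one₀ (zero_lt_iff.2 (w.ne_zero_iff.2 hz0))).1 ?_)
    rw [← map_inv₀]
    exact h _ (by simp [hz])
  refine ⟨(-WithZero.log (w t)).toNat, fun z hz => ?_⟩
  have hvz : v z = v t ^ (-WithZero.log (v z)) := by
    rw [ht, ← WithZero.exp_zsmul, smul_eq_mul, neg_mul_neg, mul_one,
      WithZero.exp_log (v.ne_zero_iff.2 hz)]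
  have hwz : w z = w t ^ (-WithZero.log (v z)) := by
    have : w (z / t ^ (-WithZero.log (v z))) = 1 := hunit _ <| by
      rw [map_div₀, map_zpow₀, ← hvz, div_self (v.ne_zero_iff.2 hz)]
    rwa [map_div₀, map_zpow₀, div_eq_one_iff_eq
      (zpow_ne_zero _ (w.ne_zero_iff.2 ht0))] at this
  rw [hwz, ← zpow_natCast, Int.toNat_of_nonneg (by omega)]
  nth_rw 1 [← WithZero.exp_log (w.ne_zero_iff.2 ht0)]
  nth_rw 2 [← WithZero.exp_log (v.ne_zero_iff.2 hz)]
  rw [← WithZero.exp_zsmul, ← WithZero.exp_zsmul, smul_eq_mul, smul_eq_mul, neg_mul_comm, mul_comm]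

theorem valuation_eq_of_forall_le_one (hv : Function.Surjective v) (hw : Function.Surjective w)
    (h : ∀ z, v z ≤ 1 → w z ≤ 1) : v = w := by
  obtain ⟨e, he⟩ := exists_valuation_eq_pow_of_forall_le_one hv h
  obtain ⟨z, hz⟩ := hw (WithZero.exp 1)
  have hz0 : z ≠ 0 := w.ne_zero_iff.1 (hz ▸ WithZero.exp_ne_zero)
  have he1 : (e : ℤ) ∣ 1 := ⟨WithZero.log (v z), by
    simpa [hz] using congrArg WithZero.log (he z hz0)⟩
  obtain rfl : e = 1 := Nat.dvd_one.1 (by exact_mod_cast he1)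
  ext z
  rcases eq_or_ne z 0 with rfl | hz
  · simp
  · rw [he z hz, pow_one]

section Dedekind

variable {B : Type*} [CommRing B] [IsDedekindDomain B] [Algebra B K] [IsFractionRing B K]

/-- The center on `B` of a valuation that is at most `1` on `B`: the prime ideal of all `b` with
`v b < 1`, obtained by contracting the maximal ideal of the valuation ring. -/
def valuationCenter (v : Valuation K ℤᵐ⁰) (hB : ∀ b : B, v (algebraMap B K b) ≤ 1) : Ideal B :=
  (IsLocalRing.maximalIdeal v.valuationSubring).comap
    ((algebraMap B K).codRestrict v.valuationSubring hB)

omit [IsDedekindDomain B] [IsFractionRing B K] in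
theorem mem_valuationCenter_iff (hB : ∀ b : B, v (algebraMap B K b) ≤ 1) (b : B) :
    b ∈ valuationCenter v hB ↔ v (algebraMap B K b) < 1 :=
  v.mem_maximalIdeal_iff (a := _)

omit [IsDedekindDomain B] in
theorem valuationCenter_ne_bot (hv : Function.Surjective v)
    (hB : ∀ b : B, v (algebraMap B K b) ≤ 1) : valuationCenter v hB ≠ ⊥ := by
  intro hbot
  have hunit : ∀ b : B, b ≠ 0 → v (algebraMap B K b) = 1 := fun b hb =>
    le_antisymm (hB b) <| not_lt.1 fun hlt => hb <| by
      simpa [hbot] using (mem_valuationCenter_iff hB b).2 hlt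
  obtain ⟨z, hz⟩ := hv (WithZero.exp 1)
  obtain ⟨a, b, -, rfl⟩ := IsFractionRing.div_surjective (A := B) z
  have hz0 := v.ne_zero_iff.1 (hz ▸ WithZero.exp_ne_zero)
  have ha : a ≠ 0 := by rintro rfl; simp at hz0
  have hb : b ≠ 0 := by rintro rfl; simp at hz0
  rw [map_div₀, hunit a ha, hunit b hb, div_one] at hz
  exact absurd hz (by simp [← WithZero.exp_zero])

theorem exists_heightOneSpectrum_valuation_eq (hv : Function.Surjective v)
    (hB : ∀ b : B, v (algebraMap B K b) ≤ 1) :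
    ∃ p : HeightOneSpectrum B, p.valuation K = v := by
  let p : HeightOneSpectrum B :=
    ⟨valuationCenter v hB, Ideal.comap_isPrime _ _, valuationCenter_ne_bot hv hB⟩
  refine ⟨p, valuation_eq_of_forall_le_one (p.valuation_surjective K) hv fun z hz => ?_⟩
  obtain ⟨a, s, ha⟩ := p.exists_primeCompl_mul_eq_of_integer z hz
  have hs : v (algebraMap B K s) = 1 :=
    le_antisymm (hB s) (not_lt.1 (mt (mem_valuationCenter_iff hB s).2 s.2))
  calc v z = v (z * algebraMap B K s) := by rw [map_mul, hs, mul_one]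
    _ ≤ 1 := ha ▸ hB a

variable (B) in
theorem valuation_eq_of_forall_lt_one_iff (hv : Function.Surjective v)
    (hw : Function.Surjective w) (hvB : ∀ b : B, v (algebraMap B K b) ≤ 1)
    (hwB : ∀ b : B, w (algebraMap B K b) ≤ 1)
    (h : ∀ b : B, v (algebraMap B K b) < 1 ↔ w (algebraMap B K b) < 1) : v = w := by
  obtain ⟨p, rfl⟩ := exists_heightOneSpectrum_valuation_eq hv hvB
  obtain ⟨q, rfl⟩ := exists_heightOneSpectrum_valuation_eq hw hwB
  have : p = q := HeightOneSpectrum.ext <| Ideal.ext fun b => by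
    rw [← p.valuation_lt_one_iff_mem (K := K), h, q.valuation_lt_one_iff_mem]
  rw [this]

theorem exp_neg_one_le_intValuation_of_squarefree [IsPrincipalIdealRing B]
    (p : HeightOneSpectrum B) {b : B} (hb : Squarefree b) :
    WithZero.exp (-1) ≤ p.intValuation b := by
  by_contra! hlt
  have hle : p.intValuation b ≤ WithZero.exp (-((2 : ℕ) : ℤ)) := by
    have h0 := p.intValuation_ne_zero b hb.ne_zero
    rw [← WithZero.exp_log h0] at hlt ⊢
    rw [WithZero.exp_lt_exp] at hlt
    rw [WithZero.exp_le_exp]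
    push_cast
    omega
  obtain ⟨π, hπ⟩ : ∃ π, p.asIdeal = Ideal.span {π} :=
    (IsPrincipalIdealRing.principal p.asIdeal).principal
  rw [p.intValuation_le_pow_iff_mem, hπ, Ideal.span_singleton_pow, Ideal.mem_span_singleton,
    sq] at hle
  exact p.isPrime.ne_top (hπ.trans (Ideal.span_singleton_eq_top.2 (hb π hle)))

end Dedekind

end Valuation

namespace Place

open IsDedekindDomain

section Basic

variable {k K : Type*} [Field k] [Field K] [Algebra k K] (P : Place k K)

instance : P.val.IsTrivialOn k := ⟨P.val_algebraMap⟩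

theorem val_algebraMap_le_one (a : k) : P.val (algebraMap k K a) ≤ 1 :=
  P.algebraMap_mem a

theorem eq_of_forall_le_one {P P' : Place k K} (h : ∀ z, P.val z ≤ 1 → P'.val z ≤ 1) : P = P' :=
  Place.ext (valuation_eq_of_forall_le_one P.surjective_val P'.surjective_val h)

theorem ord_eq_neg_of_val_eq_exp {z : K} {n : ℤ} (h : P.val z = WithZero.exp n) :
    P.ord z = ((-n : ℤ) : WithTop ℤ) := by
  have hz : z ≠ 0 := P.val.ne_zero_iff.1 (h ▸ WithZero.exp_ne_zero)
  rw [ord, if_neg hz, h, WithZero.log_exp]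

theorem isPole_iff (z : K) : P.IsPole z ↔ 1 < P.val z := by
  rw [IsPole, ← not_le, ← not_le, not_iff_not]
  exact (P.mem_integers_iff z).symm

section EvalEq

variable {P} {f g : K} {a b : k}

theorem evalEq_iff : P.EvalEq f a ↔ P.val (f - algebraMap k K a) < 1 := by
  have residue_eq_iff (h : f ∈ P.integers) :
      IsLocalRing.residue P.integers ⟨f, h⟩ = P.constEmbedding a ↔
        P.val (f - algebraMap k K a) < 1 := by
    rw [constEmbedding, RingHom.comp_apply, ← sub_eq_zero, ← map_sub,
      IsLocalRing.residue_eq_zero_iff]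
    exact P.val.mem_maximalIdeal_iff (a := _)
  refine ⟨fun ⟨h, hf⟩ => (residue_eq_iff h).1 hf, fun h => ?_⟩
  have hf : f ∈ P.integers := by
    simpa using P.val.map_add_le h.le (P.val_algebraMap_le_one a)
  exact ⟨hf, (residue_eq_iff hf).2 h⟩

theorem EvalEq.unique (ha : P.EvalEq f a) (hb : P.EvalEq f b) : a = b := by
  obtain ⟨_, ha⟩ := ha
  obtain ⟨_, hb⟩ := hb
  exact P.constEmbedding.injective (ha.symm.trans hb)

theorem EvalEq.algebraMap_mul (c : k) (h : P.EvalEq f a) :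
    P.EvalEq (algebraMap k K c * f) (c * a) := by
  rw [evalEq_iff] at h ⊢
  rw [map_mul, ← mul_sub, map_mul]
  exact mul_lt_one_of_nonneg_of_lt_one_right (P.val_algebraMap_le_one c) zero_le h

theorem EvalEq.val_eq_one (h : P.EvalEq f a) (ha : a ≠ 0) : P.val f = 1 := by
  rw [evalEq_iff, ← P.val_algebraMap a ha] at h
  rw [P.val.map_eq_of_sub_lt h, P.val_algebraMap a ha]

theorem EvalEq.val_pow_sub_pow_lt_one (h : P.EvalEq f a) (n : ℕ) :
    P.val (f ^ n - algebraMap k K a ^ n) < 1 := by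
  obtain ⟨hf, -⟩ := id h
  obtain ⟨⟨c, hc⟩, hdvd⟩ := sub_dvd_pow_sub_pow (⟨f, hf⟩ : P.integers)
    ⟨algebraMap k K a, P.algebraMap_mem a⟩ n
  have hfac : f ^ n - algebraMap k K a ^ n = (f - algebraMap k K a) * c :=
    congrArg Subtype.val hdvd
  rw [hfac, map_mul]
  exact mul_lt_one_of_lt_of_le (evalEq_iff.1 h) hc

end EvalEq

theorem isRational_of_forall_exists_evalEq (h : ∀ z, P.val z ≤ 1 → ∃ a : k, P.EvalEq z a) :
    P.IsRational := by
  have hsurj : Function.Surjective P.constEmbedding := by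
    intro r
    obtain ⟨⟨z, hz⟩, rfl⟩ := IsLocalRing.residue_surjective r
    obtain ⟨a, _, ha⟩ := h z hz
    exact ⟨a, ha.symm⟩
  unfold IsRational degree
  let : Algebra k P.residueField := P.constEmbedding.toAlgebra
  rw [← (LinearEquiv.ofBijective (Algebra.linearMap k P.residueField)
    ⟨P.constEmbedding.injective, hsurj⟩).finrank_eq, Module.finrank_self]

instance isDiscreteValuationRing_integers : IsDiscreteValuationRing P.integers := by
  have : P.val.IsNontrivial := by
    obtain ⟨t, ht⟩ := P.surjective_val (WithZero.exp 1)
    exact ⟨t, ht ▸ WithZero.exp_ne_zero, by rw [ht]; simp [← WithZero.exp_zero]⟩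
  have : Nontrivial (MonoidWithZeroHom.valueGroup (.ofClass P.val)) := inferInstance
  have : IsCyclic (MonoidWithZeroHom.valueGroup (.ofClass P.val)) := inferInstance
  exact Valuation.valuationSubring_isDiscreteValuationRing P.val

/-- The place given by a normalized valuation that is at most `1` on the constants; it is then
trivial on them, because the inverse of a constant is a constant. -/
noncomputable def ofValuation (v : Valuation K ℤᵐ⁰) (hv : Function.Surjective v)
    (hk : ∀ a : k, v (algebraMap k K a) ≤ 1) : Place k K where
  val := v
  surjective_val := hv
  val_algebraMap a ha := by
    have hne : v (algebraMap k K a) ≠ 0 := by simpa using ha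
    refine le_antisymm (hk a) ((inv_le_one₀ (zero_lt_iff.2 hne)).1 ?_)
    rw [← map_inv₀, ← map_inv₀]
    exact hk a⁻¹

end Basic

section Extension

variable {k F E : Type*} [Field k] [Field F] [Field E] [Algebra k F] [Algebra k E] [Algebra F E]
  {P : Place k E} {Q : Place k F}

theorem liesAbove_iff :
    P.LiesAbove Q ↔ ∀ z : F, P.val (algebraMap F E z) ≤ 1 ↔ Q.val z ≤ 1 :=
  SetLike.ext_iff

omit [Algebra k E] in
theorem isIntegral_algebraMap_iff_val_le_one (z : F) :
    IsIntegral Q.integers (algebraMap F E z) ↔ Q.val z ≤ 1 := by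
  rw [isIntegral_algebraMap_iff (algebraMap F E).injective, IsIntegrallyClosed.isIntegral_iff]
  exact ⟨fun ⟨y, hy⟩ => hy ▸ y.2, fun h => ⟨⟨z, h⟩, rfl⟩⟩

theorem LiesAbove.val_le_one_of_isIntegral (h : P.LiesAbove Q) {z : E}
    (hz : IsIntegral Q.integers z) : P.val z ≤ 1 := by
  have hint : IsIntegral P.integers z := hz.map_of_comp_eq
    ((algebraMap F E).restrict Q.integers P.integers fun z => (liesAbove_iff.1 h z).2)
    (RingHom.id E) rfl
  exact Valuation.Integers.mem_of_integral (Valuation.integer.integers P.val) hint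

theorem LiesAbove.exists_hasRamificationIndex (h : P.LiesAbove Q) :
    ∃ e : ℕ, e ≠ 0 ∧ P.HasRamificationIndex Q e := by
  obtain ⟨e, he⟩ := exists_valuation_eq_pow_of_forall_le_one
    (w := P.val.comap (algebraMap F E)) Q.surjective_val fun z => (liesAbove_iff.1 h z).2
  obtain ⟨z, hz⟩ := Q.surjective_val (WithZero.exp 1)
  have hz0 : z ≠ 0 := Q.val.ne_zero_iff.1 (hz ▸ WithZero.exp_ne_zero)
  have he0 : e ≠ 0 := by
    rintro rfl
    have := (liesAbove_iff.1 h z).1 ((he z hz0).trans (pow_zero _)).le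
    rw [hz] at this
    exact absurd this (by simp [← WithZero.exp_zero])
  refine ⟨e, he0, h, fun z => ?_⟩
  rcases eq_or_ne z 0 with rfl | hz
  · simp [he0]
  · exact he z hz

theorem LiesAbove.val_lt_one_iff (h : P.LiesAbove Q) (z : F) :
    P.val (algebraMap F E z) < 1 ↔ Q.val z < 1 := by
  obtain ⟨e, he, -, hP⟩ := h.exists_hasRamificationIndex
  rw [hP, pow_lt_one_iff_of_nonneg zero_le he]

theorem HasRamificationIndex.val_eq_of_pow_eq {e : ℕ} (h : P.HasRamificationIndex Q e)
    (he : e ≠ 0) {z : E} {a : F} (hz : z ^ e = algebraMap F E a) : P.val z = Q.val a := by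
  rw [← pow_left_inj₀ zero_le zero_le he, ← map_pow, hz, h.2]

-- If `ν_P` were nonnegative on all of `F`, every element of `E` would be integral at `P`.
theorem liesAbove_of_forall_val_le_one [Algebra.IsAlgebraic F E]
    (h : ∀ z : F, Q.val z ≤ 1 → P.val (algebraMap F E z) ≤ 1) : P.LiesAbove Q := by
  obtain ⟨e, he⟩ := exists_valuation_eq_pow_of_forall_le_one
    (w := P.val.comap (algebraMap F E)) Q.surjective_val h
  have he0 : e ≠ 0 := by
    rintro rfl
    obtain ⟨z, hz⟩ := P.surjective_val (WithZero.exp 1)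
    have hF (x : F) : algebraMap F E x ∈ P.integers := by
      rcases eq_or_ne x 0 with rfl | hx
      · simp
      · exact ((he x hx).trans (pow_zero _)).le
    have hint : IsIntegral P.integers z :=
      (Algebra.IsIntegral.isIntegral (R := F) z).map_of_comp_eq
        ((algebraMap F E).codRestrict P.integers hF) (RingHom.id E) rfl
    have := Valuation.Integers.mem_of_integral (Valuation.integer.integers P.val) hint
    rw [Valuation.mem_integer_iff, hz] at this
    exact absurd this (by simp [← WithZero.exp_zero])
  refine liesAbove_iff.2 fun z => ?_
  rcases eq_or_ne z 0 with rfl | hz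
  · simp
  · rw [← pow_le_one_iff_of_nonneg (a := Q.val z) zero_le he0, ← he z hz]
    rfl

variable [IsScalarTower k F E]

variable (E) in
theorem exists_liesAbove [FiniteDimensional F E] [Algebra.IsSeparable F E] (Q : Place k F) :
    ∃ P : Place k E, P.LiesAbove Q := by
  have := integralClosure.isDedekindDomain Q.integers F E
  have := integralClosure.isFractionRing_of_finite_extension (A := Q.integers) F E
  have hinj : Function.Injective (algebraMap Q.integers (integralClosure Q.integers E)) :=
    fun x y hxy => Subtype.ext ((algebraMap F E).injective (congrArg Subtype.val hxy))
  have hfield : ¬ IsField (integralClosure Q.integers E) := fun h =>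
    IsDiscreteValuationRing.not_isField Q.integers (isField_of_isIntegral_of_isField hinj h)
  obtain ⟨p, hbot, hp⟩ := Ring.not_isField_iff_exists_prime.1 hfield
  let q : HeightOneSpectrum (integralClosure Q.integers E) := ⟨p, hp, hbot⟩
  have hle (z : F) (hz : Q.val z ≤ 1) : q.valuation E (algebraMap F E z) ≤ 1 :=
    q.valuation_le_one (algebraMap Q.integers (integralClosure Q.integers E) ⟨z, hz⟩)
  refine ⟨ofValuation (q.valuation E) (q.valuation_surjective E) fun a => ?_,
    liesAbove_of_forall_val_le_one hle⟩
  rw [IsScalarTower.algebraMap_apply k F E]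
  exact hle _ (Q.val_algebraMap_le_one a)

/-- The conjugate of the place `P` by `σ`, with `ν_{P.conj σ}(z) = ν_P(σ z)`. -/
noncomputable def conj (P : Place k E) (σ : E ≃ₐ[F] E) : Place k E where
  val := P.val.comap (σ : E →+* E)
  surjective_val := P.surjective_val.comp σ.surjective
  val_algebraMap a ha := by
    have : σ (algebraMap k E a) = algebraMap k E a := by
      rw [IsScalarTower.algebraMap_apply k F E, σ.commutes]
    exact (congrArg P.val this).trans (P.val_algebraMap a ha)

theorem LiesAbove.conj (h : P.LiesAbove Q) (σ : E ≃ₐ[F] E) : (P.conj σ).LiesAbove Q :=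
  liesAbove_iff.2 fun z =>
    (congrArg (P.val · ≤ 1) (σ.commutes z)).to_iff.trans (liesAbove_iff.1 h z)

theorem conj_evalEq_iff (σ : E ≃ₐ[F] E) {f : E} {a : k} :
    (P.conj σ).EvalEq f a ↔ P.EvalEq (σ f) a := by
  have : σ (f - algebraMap k E a) = σ f - algebraMap k E a := by
    rw [map_sub, IsScalarTower.algebraMap_apply k F E, σ.commutes]
  rw [evalEq_iff, evalEq_iff, ← this]
  rfl

end Extension

end Place

section RationalFunctionField

namespace Place

open Polynomial

variable {k : Type*} [Field k]

open Classical in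
variable (k) in
/-- The place at infinity of the rational function field, `ν_∞(f / g) = deg g - deg f`. -/
noncomputable def infty : Place k (RatFunc k) :=
  ofValuation (RatFunc.inftyValuation k)
    (fun x => by
      rcases eq_or_ne x 0 with rfl | hx
      · exact ⟨0, map_zero _⟩
      · exact ⟨RatFunc.X ^ WithZero.log x,
          (RatFunc.inftyValuation.X_zpow k _).trans (WithZero.exp_log hx)⟩)
    fun a => by
      rcases eq_or_ne a 0 with rfl | ha
      · simp
      · exact (RatFunc.inftyValuation.C k ha).le

theorem val_infty {z : RatFunc k} (hz : z ≠ 0) : (infty k).val z = WithZero.exp z.intDegree := by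
  classical exact RatFunc.inftyValuation_of_nonzero k hz

theorem val_infty_X : (infty k).val RatFunc.X = WithZero.exp 1 := by
  rw [val_infty RatFunc.X_ne_zero, RatFunc.intDegree_X]

theorem val_infty_algebraMap {f : k[X]} (hf : f ≠ 0) :
    (infty k).val (algebraMap k[X] (RatFunc k) f) = WithZero.exp (f.natDegree : ℤ) := by
  rw [val_infty (RatFunc.algebraMap_ne_zero hf), RatFunc.intDegree_polynomial]

theorem isPole_X_iff (Q : Place k (RatFunc k)) : Q.IsPole RatFunc.X ↔ Q = infty k := by
  classical
  rw [isPole_iff]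
  refine ⟨fun hX => eq_of_forall_le_one fun z hz => ?_, ?_⟩
  · exact (RatFunc.valuation_isEquiv_inftyValuation_of_one_lt_valuation_X hX).le_one_iff_le_one.1 hz
  · rintro rfl
    rw [val_infty_X, ← WithZero.exp_zero, WithZero.exp_lt_exp]
    exact zero_lt_one

theorem val_infty_div_lt_one {f g : k[X]} (h : f.degree < g.degree) :
    (infty k).val (algebraMap k[X] (RatFunc k) f / algebraMap k[X] (RatFunc k) g) < 1 := by
  rcases eq_or_ne f 0 with rfl | hf
  · simp
  have hg : g ≠ 0 := ne_zero_of_degree_gt h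
  rw [map_div₀, val_infty_algebraMap hf, val_infty_algebraMap hg, ← WithZero.exp_sub,
    ← WithZero.exp_zero, WithZero.exp_lt_exp]
  have := natDegree_lt_natDegree hf h
  omega

theorem isRational_infty : (infty k).IsRational := by
  refine isRational_of_forall_exists_evalEq _ fun z hz => ?_
  have hdenom : algebraMap k[X] (RatFunc k) z.denom ≠ 0 :=
    RatFunc.algebraMap_ne_zero z.denom_ne_zero
  rcases lt_or_ge z.num.degree z.denom.degree with hlt | hge
  · refine ⟨0, evalEq_iff.2 ?_⟩
    simpa [RatFunc.num_div_denom] using val_infty_div_lt_one hlt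
  have hnum : z.num ≠ 0 := fun h => z.denom_ne_zero (by simpa [h] using hge)
  have hz0 : z ≠ 0 := fun h => hnum (RatFunc.num_eq_zero_iff.2 h)
  rw [val_infty hz0, ← WithZero.exp_zero, WithZero.exp_le_exp, RatFunc.intDegree] at hz
  have hdegree : (C z.num.leadingCoeff * z.denom).degree = z.num.degree := by
    rw [degree_C_mul (leadingCoeff_ne_zero.2 hnum)]
    refine le_antisymm hge ?_
    rw [degree_eq_natDegree hnum, degree_eq_natDegree z.denom_ne_zero, Nat.cast_le]
    omega
  refine ⟨z.num.leadingCoeff, evalEq_iff.2 ?_⟩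
  have hsub : z - algebraMap k (RatFunc k) z.num.leadingCoeff =
      algebraMap k[X] (RatFunc k) (z.num - C z.num.leadingCoeff * z.denom) /
        algebraMap k[X] (RatFunc k) z.denom := by
    rw [map_sub, map_mul, sub_div, RatFunc.num_div_denom, mul_div_cancel_right₀ _ hdenom,
      RatFunc.algebraMap_C, RatFunc.algebraMap_eq_C]
  rw [hsub]
  refine val_infty_div_lt_one ((degree_sub_lt_left hdegree.symm hnum ?_).trans_le ?_)
  · rw [leadingCoeff_mul, leadingCoeff_C, z.monic_denom.leadingCoeff, mul_one]
  · rw [← hdegree, degree_C_mul (leadingCoeff_ne_zero.2 hnum)]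

theorem val_algebraMap_polynomial_le_one {Q : Place k (RatFunc k)} (hQ : Q ≠ infty k) (f : k[X]) :
    Q.val (algebraMap k[X] (RatFunc k) f) ≤ 1 := by
  refine Polynomial.valuation_le_one_of_valuation_X_le_one _ ?_ f
  rw [← not_lt, ← isPole_iff, isPole_X_iff]
  exact hQ

theorem exp_neg_one_le_val_of_squarefree {Q : Place k (RatFunc k)} (hQ : Q ≠ infty k) {f : k[X]}
    (hf : Squarefree f) : WithZero.exp (-1) ≤ Q.val (algebraMap k[X] (RatFunc k) f) := by
  obtain ⟨p, hp⟩ := exists_heightOneSpectrum_valuation_eq Q.surjective_val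
    (val_algebraMap_polynomial_le_one hQ)
  rw [← hp, p.valuation_of_algebraMap]
  exact exp_neg_one_le_intValuation_of_squarefree p hf

end Place

end RationalFunctionField

section Kummer

section Auxiliary

variable {K : Type*} [Field K] {m : ℕ}

theorem eq_of_pow_mul_pow_eq {i j : ℕ} (hi : i < m) (hj : j < m) {x x' b : ℤᵐ⁰}
    (hb : IsCoprime (WithZero.log b) m) (hne : x ^ m * b ^ i ≠ 0)
    (h : x ^ m * b ^ i = x' ^ m * b ^ j) : i = j := by
  have hlog := congrArg WithZero.log h
  rw [WithZero.log_mul (left_ne_zero_of_mul hne) (right_ne_zero_of_mul hne),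
    WithZero.log_mul (left_ne_zero_of_mul (h ▸ hne)) (right_ne_zero_of_mul (h ▸ hne))] at hlog
  simp only [WithZero.log_pow, nsmul_eq_mul] at hlog
  have hdvd : (m : ℤ) ∣ i - j := hb.symm.dvd_of_dvd_mul_right
    ⟨WithZero.log x' - WithZero.log x, by linear_combination hlog⟩
  have := Int.eq_zero_of_abs_lt_dvd hdvd (abs_lt.2 (by omega))
  omega

theorem sum_inv_pow_smul_pow_apply_sum {V : Type*} [AddCommGroup V] [Module K V] {ζ : K}
    (hζ : IsPrimitiveRoot ζ m) {T : Module.End K V} {x : Fin m → V}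
    (hx : ∀ l, T (x l) = ζ ^ (l : ℕ) • x l) (i : Fin m) :
    ∑ j ∈ Finset.range m, (ζ⁻¹ ^ (i : ℕ)) ^ j • (T ^ j) (∑ l, x l) = (m : K) • x i := by
  have hζ0 : ζ ≠ 0 := hζ.ne_zero i.pos.ne'
  have hpow (l : Fin m) (j : ℕ) : (T ^ j) (x l) = (ζ ^ (l : ℕ)) ^ j • x l := by
    induction j with
    | zero => simp
    | succ j ih => rw [pow_succ', Module.End.mul_apply, ih, map_smul, hx, smul_smul, ← pow_succ]
  have hgeom (l : Fin m) : ∑ j ∈ Finset.range m, (ζ⁻¹ ^ (i : ℕ) * ζ ^ (l : ℕ)) ^ j =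
      if l = i then (m : K) else 0 := by
    split_ifs with h
    · simp [h, hζ0]
    · have hne : ζ⁻¹ ^ (i : ℕ) * ζ ^ (l : ℕ) ≠ 1 := fun h1 => h <| Fin.ext <|
        hζ.pow_inj l.2 i.2 (by rwa [inv_pow, inv_mul_eq_one₀ (pow_ne_zero _ hζ0), eq_comm] at h1)
      have hone : (ζ⁻¹ ^ (i : ℕ) * ζ ^ (l : ℕ)) ^ m = 1 := by
        rw [mul_pow, pow_right_comm, pow_right_comm ζ, inv_pow, hζ.pow_eq_one]
        simp
      rw [geom_sum_eq hne, hone, sub_self, zero_div]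
  calc ∑ j ∈ Finset.range m, (ζ⁻¹ ^ (i : ℕ)) ^ j • (T ^ j) (∑ l, x l)
      = ∑ l : Fin m, (∑ j ∈ Finset.range m, (ζ⁻¹ ^ (i : ℕ) * ζ ^ (l : ℕ)) ^ j) • x l := by
        simp only [map_sum, Finset.smul_sum, hpow, smul_smul, ← mul_pow, Finset.sum_smul]
        exact Finset.sum_comm
    _ = (m : K) • x i := by
        simp only [hgeom, ite_smul, zero_smul, Finset.sum_ite_eq', Finset.mem_univ, if_true]

theorem encard_setOf_pow_eq_pow (hm : 0 < m) {ω α : K} (hω : IsPrimitiveRoot ω m)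
    (hα : α ≠ 0) : {β : K | β ^ m = α ^ m}.encard = m := by
  classical
  have : {β : K | β ^ m = α ^ m} = (Polynomial.nthRoots m (α ^ m)).toFinset := by
    ext β
    simp [Polynomial.mem_nthRoots hm]
  rw [this, Set.encard_coe_eq_coe_finsetCard,
    Multiset.toFinset_card_of_nodup (hω.nthRoots_nodup (pow_ne_zero m hα)), hω.card_nthRoots,
    if_pos ⟨α, rfl⟩]

end Auxiliary

namespace Place

variable {k F E : Type*} [Field k] [Field F] [Field E] [Algebra k F] [Algebra k E] [Algebra F E]
  [IsScalarTower k F E] {P : Place k E} {Q : Place k F} {m : ℕ} {a : F} {y : E}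

theorem LiesAbove.exists_evalEq_of_pow_eq (hP : P.LiesAbove Q) (hm : 0 < m) {ω : k}
    (hω : IsPrimitiveRoot ω m) (hy : y ^ m = algebraMap F E a) {α : k}
    (hQ : Q.EvalEq a (α ^ m)) : ∃ β : k, β ^ m = α ^ m ∧ P.EvalEq y β := by
  have hωE : IsPrimitiveRoot (algebraMap k E ω) m :=
    hω.map_of_injective (algebraMap k E).injective
  have hlt := (hP.val_lt_one_iff _).2 (evalEq_iff.1 hQ)
  rw [map_sub, ← hy, ← IsScalarTower.algebraMap_apply, map_pow,
    hωE.pow_sub_pow_eq_prod_sub_mul y (algebraMap k E α) hm, map_prod] at hlt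
  obtain ⟨ζ, hζ, hζlt⟩ : ∃ ζ ∈ Polynomial.nthRootsFinset m (1 : E),
      P.val (y - ζ * algebraMap k E α) < 1 := by
    by_contra! hcon
    exact hlt.not_ge (Finset.one_le_prod' hcon)
  have : NeZero m := ⟨hm.ne'⟩
  obtain ⟨j, -, rfl⟩ := hωE.eq_pow_of_pow_eq_one ((Polynomial.mem_nthRootsFinset hm _).1 hζ)
  refine ⟨ω ^ j * α, ?_, evalEq_iff.2 (by simpa using hζlt)⟩
  rw [mul_pow, pow_right_comm, hω.pow_eq_one, one_pow, one_mul]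

theorem LiesAbove.val_sum_smul_pow_lt_one_iff (hP : P.LiesAbove Q) {β : k} (hβ : P.EvalEq y β)
    {c : Fin m → F} (hc : ∀ i, Q.val (c i) ≤ 1) :
    P.val (∑ i, c i • y ^ (i : ℕ)) < 1 ↔ Q.val (∑ i, c i * algebraMap k F β ^ (i : ℕ)) < 1 := by
  rw [← hP.val_lt_one_iff]
  refine valuation_sub_lt_one_iff ?_
  rw [map_sum, ← Finset.sum_sub_distrib]
  refine P.val.map_sum_lt one_ne_zero fun i _ => ?_
  rw [Algebra.smul_def, map_mul, map_pow, ← IsScalarTower.algebraMap_apply, ← mul_sub, map_mul]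
  exact mul_lt_one_of_nonneg_of_lt_one_right ((liesAbove_iff.1 hP _).2 (hc i)) zero_le
    (hβ.val_pow_sub_pow_lt_one i)

end Place

/-- `y` is an `m`-th root of `a ∈ F` with `E = F(y)` and `[E : F] = m`: the data of a Kummer
extension `E / F`, except for the `m`-th roots of unity in `F`. -/
structure IsKummerGenerator {F E : Type*} [Field F] [Field E] [Algebra F E] (m : ℕ) (a : F)
    (y : E) : Prop where
  pos : 0 < m
  pow_eq : y ^ m = algebraMap F E a
  adjoin_eq_top : IntermediateField.adjoin F {y} = ⊤
  finrank_eq : Module.finrank F E = m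

namespace IsKummerGenerator

open Polynomial

section Field

variable {F E : Type*} [Field F] [Field E] [Algebra F E] {m : ℕ} {a : F} {y : E}

-- Taking norms in `y ^ m = a` gives `N(y) ^ m = a ^ [E : F]`, hence `m ∣ [E : F] * v(a)`.
theorem of_isCoprime_log (hm : 0 < m) (hy : y ^ m = algebraMap F E a)
    (hE : IntermediateField.adjoin F {y} = ⊤) (v : Valuation F ℤᵐ⁰)
    (hv : IsCoprime (WithZero.log (v a)) m) : IsKummerGenerator m a y := by
  have hint : IsIntegral F y := .of_pow hm (hy ▸ isIntegral_algebraMap)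
  have hdegree : (minpoly F y).natDegree = Module.finrank F E := by
    rw [← IntermediateField.adjoin.finrank hint, hE, IntermediateField.finrank_top']
  have hle : Module.finrank F E ≤ m := by
    rw [← hdegree, ← natDegree_X_pow_sub_C (n := m) (r := a)]
    exact natDegree_le_of_dvd (minpoly.dvd F y (by simp [hy])) (X_pow_sub_C_ne_zero hm a)
  have hdvd : m ∣ Module.finrank F E := by
    have hnorm : Algebra.norm F y ^ m = a ^ Module.finrank F E := by
      rw [← map_pow, hy, Algebra.norm_algebraMap]
    have hlog := congrArg (fun z => WithZero.log (v z)) hnorm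
    simp only [map_pow, WithZero.log_pow, nsmul_eq_mul] at hlog
    exact_mod_cast hv.symm.dvd_of_dvd_mul_right (Dvd.intro _ hlog)
  have hpos : 0 < Module.finrank F E := hdegree ▸ minpoly.natDegree_pos hint
  exact ⟨hm, hy, hE, hle.antisymm (Nat.le_of_dvd hpos hdvd)⟩

variable (h : IsKummerGenerator m a y)
include h

theorem finiteDimensional : FiniteDimensional F E :=
  .of_finrank_pos (h.finrank_eq ▸ h.pos)

theorem irreducible : Irreducible (X ^ m - C a) := by
  have := h.finiteDimensional
  have hy := h.pow_eq
  rw [← h.finrank_eq] at hy ⊢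
  exact irreducible_X_pow_sub_C_of_root_adjoin_eq_top hy h.adjoin_eq_top

theorem isSplittingField {ζ : F} (hζ : IsPrimitiveRoot ζ m) :
    IsSplittingField F E (X ^ m - C a) := by
  have := h.finiteDimensional
  have hne : (primitiveRoots m F).Nonempty := ⟨ζ, (mem_primitiveRoots h.pos).2 hζ⟩
  have hy := h.pow_eq
  rw [← h.finrank_eq] at hy hne ⊢
  exact isSplittingField_X_pow_sub_C_of_root_adjoin_eq_top hne hy h.adjoin_eq_top

theorem isGalois {ζ : F} (hζ : IsPrimitiveRoot ζ m) : IsGalois F E :=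
  have := h.isSplittingField hζ
  isGalois_of_isSplittingField_X_pow_sub_C ⟨ζ, (mem_primitiveRoots h.pos).2 hζ⟩ h.irreducible E

theorem exists_algEquiv_apply_eq {ζ : F} (hζ : IsPrimitiveRoot ζ m) {η : F} (hη : η ^ m = 1) :
    ∃ σ : E ≃ₐ[F] E, σ y = η • y := by
  have := h.isSplittingField hζ
  have : NeZero m := ⟨h.pos.ne'⟩
  have hne : (primitiveRoots m F).Nonempty := ⟨ζ, (mem_primitiveRoots h.pos).2 hζ⟩
  let e := autEquivRootsOfUnity hne h.irreducible E
  refine ⟨e.symm (rootsOfUnity.mkOfPowEq η hη), ?_⟩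
  rw [← autEquivRootsOfUnity_smul hne h.irreducible E h.pow_eq, e.apply_symm_apply]
  rfl

theorem linearIndependent_pow : LinearIndependent F fun i : Fin m => y ^ (i : ℕ) := by
  have := h.finiteDimensional
  have hdegree : (minpoly F y).natDegree = m := by
    rw [← IntermediateField.adjoin.finrank (.of_finite F y), h.adjoin_eq_top,
      IntermediateField.finrank_top', h.finrank_eq]
  exact hdegree ▸ _root_.linearIndependent_pow (K := F) y

theorem exists_eq_sum_smul_pow (z : E) : ∃ c : Fin m → F, z = ∑ i, c i • y ^ (i : ℕ) := by
  have : Nonempty (Fin m) := ⟨⟨0, h.pos⟩⟩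
  let b := basisOfLinearIndependentOfCardEqFinrank h.linearIndependent_pow
    (by rw [h.finrank_eq, Fintype.card_fin])
  exact ⟨b.repr z, by simpa [b] using (b.sum_repr z).symm⟩

theorem smul_pow_pow (c : F) (i : ℕ) : (c • y ^ i) ^ m = algebraMap F E (c ^ m * a ^ i) := by
  rw [_root_.smul_pow, pow_right_comm, h.pow_eq, Algebra.smul_def, map_mul, map_pow, map_pow]

end Field

variable {k F E : Type*} [Field k] [Field F] [Field E] [Algebra k F] [Algebra k E] [Algebra F E]
  {P : Place k E} {Q : Place k F} {m : ℕ} {a : F} {y : E} (h : IsKummerGenerator m a y)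
include h

theorem exists_mulEquiv_zpowers [IsScalarTower k F E] {ω : kˣ} (hω : IsPrimitiveRoot ω m) :
    ∃ φ : (E ≃ₐ[F] E) ≃* Subgroup.zpowers ω,
      ∀ σ : E ≃ₐ[F] E, σ y = algebraMap k E ((φ σ : kˣ) : k) * y := by
  have hωk : IsPrimitiveRoot (ω : k) m := IsPrimitiveRoot.coe_units_iff.2 hω
  have hωF := hωk.map_of_injective (algebraMap k F).injective
  have := h.isSplittingField hωF
  have : NeZero m := ⟨h.pos.ne'⟩
  let e := autEquivRootsOfUnity ⟨_, (mem_primitiveRoots h.pos).2 hωF⟩ h.irreducible E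
  let r := rootsOfUnityEquivOfPrimitiveRoots (algebraMap k F).injective
    ⟨_, (mem_primitiveRoots h.pos).2 hωk⟩
  refine ⟨(e.trans r.symm).trans (MulEquiv.subgroupCongr hω.zpowers_eq.symm), fun σ => ?_⟩
  have hr : algebraMap k F ((r.symm (e σ) : kˣ) : k) = ((e σ : Fˣ) : F) :=
    rootsOfUnityEquivOfPrimitiveRoots_symm_apply _ _ _
  calc σ y = ((e σ : Fˣ) : F) • y := (autEquivRootsOfUnity_smul _ _ E h.pow_eq σ).symm
    _ = algebraMap k E ((r.symm (e σ) : kˣ) : k) * y := by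
      rw [IsScalarTower.algebraMap_apply k F E, hr, Algebra.smul_def]

section TotallyRamified

variable (hv : IsCoprime (WithZero.log (Q.val a)) m)
include hv

theorem exists_val_sum_eq (hP : P.LiesAbove Q) (c : Fin m → F) :
    ∃ i, P.val (∑ i, c i • y ^ (i : ℕ)) = P.val (c i • y ^ (i : ℕ)) ∧
      ∀ j : Fin m, P.val (c j • y ^ (j : ℕ)) ≤ P.val (c i • y ^ (i : ℕ)) := by
  have : Nonempty (Fin m) := ⟨⟨0, h.pos⟩⟩
  obtain ⟨e, he, -, hPe⟩ := hP.exists_hasRamificationIndex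
  have hpow (i : Fin m) :
      P.val (c i • y ^ (i : ℕ)) ^ m = (Q.val (c i) ^ m * Q.val a ^ (i : ℕ)) ^ e := by
    rw [← map_pow, h.smul_pow_pow, hPe, map_mul, map_pow, map_pow]
  refine exists_valuation_sum_eq P.val (fun i : Fin m => c i • y ^ (i : ℕ)) fun i j hi hij => ?_
  refine Fin.ext (eq_of_pow_mul_pow_eq i.2 j.2 hv (x := Q.val (c i)) (x' := Q.val (c j)) ?_ ?_)
  · exact (pow_ne_zero_iff he).1 (hpow i ▸ pow_ne_zero m hi)
  · rw [← pow_left_inj₀ zero_le zero_le he, ← hpow, ← hpow, hij]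

theorem val_sum_le_one_iff (hP : P.LiesAbove Q) (c : Fin m → F) :
    P.val (∑ i, c i • y ^ (i : ℕ)) ≤ 1 ↔ ∀ i : Fin m, Q.val (c i ^ m * a ^ (i : ℕ)) ≤ 1 := by
  have hterm (i : Fin m) :
      P.val (c i • y ^ (i : ℕ)) ≤ 1 ↔ Q.val (c i ^ m * a ^ (i : ℕ)) ≤ 1 := by
    rw [← Place.liesAbove_iff.1 hP, ← h.smul_pow_pow, map_pow,
      pow_le_one_iff_of_nonneg zero_le h.pos.ne']
  obtain ⟨i, hi, hmax⟩ := h.exists_val_sum_eq hv hP c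
  simp only [hi, ← hterm]
  exact ⟨fun hle j => (hmax j).trans hle, fun hle => hle i⟩

theorem eq_of_liesAbove {P' : Place k E} (hP : P.LiesAbove Q) (hP' : P'.LiesAbove Q) : P = P' := by
  refine Place.eq_of_forall_le_one fun z hz => ?_
  obtain ⟨c, rfl⟩ := h.exists_eq_sum_smul_pow z
  rwa [h.val_sum_le_one_iff hv hP', ← h.val_sum_le_one_iff hv hP]

theorem hasRamificationIndex (hP : P.LiesAbove Q) : P.HasRamificationIndex Q m := by
  obtain ⟨e, he, -, hPe⟩ := hP.exists_hasRamificationIndex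
  obtain ⟨t, rfl⟩ : m ∣ e := by
    have hlog := congrArg WithZero.log (hPe a)
    rw [← h.pow_eq, map_pow, WithZero.log_pow, WithZero.log_pow, nsmul_eq_mul, nsmul_eq_mul]
      at hlog
    exact_mod_cast hv.symm.dvd_of_dvd_mul_right (Dvd.intro _ hlog)
  obtain ⟨z, hz⟩ := P.surjective_val (WithZero.exp 1)
  obtain ⟨c, rfl⟩ := h.exists_eq_sum_smul_pow z
  obtain ⟨i, hi, -⟩ := h.exists_val_sum_eq hv hP c
  have hpow : P.val (c i • y ^ (i : ℕ)) = Q.val (c i ^ m * a ^ (i : ℕ)) ^ t := by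
    rw [← pow_left_inj₀ zero_le zero_le h.pos.ne', ← map_pow, h.smul_pow_pow, hPe, ← pow_mul,
      mul_comm t]
  have ht : (t : ℤ) ∣ 1 := by
    have hlog := congrArg WithZero.log (hz.symm.trans (hi.trans hpow))
    rw [WithZero.log_exp, WithZero.log_pow, nsmul_eq_mul] at hlog
    exact Dvd.intro _ hlog.symm
  obtain rfl : t = 1 := Nat.dvd_one.1 (by exact_mod_cast ht)
  exact ⟨hP, by simpa using hPe⟩

end TotallyRamified

section IntegralBasis

omit [Algebra k E]

variable {ζ : F} (hζ : IsPrimitiveRoot ζ m)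
include hζ

theorem isIntegral_smul_pow (c : Fin m → F)
    (hc : IsIntegral Q.integers (∑ i, c i • y ^ (i : ℕ))) (i : Fin m) :
    IsIntegral Q.integers (c i • y ^ (i : ℕ)) := by
  have : NeZero m := ⟨h.pos.ne'⟩
  have hm : (m : F) ≠ 0 := hζ.neZero'.out
  have hminv : Q.val (m : F)⁻¹ ≤ 1 := by
    simpa using Q.val_algebraMap_le_one (m : k)⁻¹
  have hζinv : Q.val ζ⁻¹ ≤ 1 := by
    rw [← pow_le_one_iff_of_nonneg zero_le h.pos.ne', ← map_pow, hζ.inv.pow_eq_one, map_one]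
  have hcoeff (j : ℕ) : Q.val ((ζ⁻¹ ^ (i : ℕ)) ^ j) ≤ 1 := by
    rw [map_pow, map_pow]
    exact pow_le_one' (pow_le_one' hζinv _) _
  obtain ⟨σ, hσ⟩ := h.exists_algEquiv_apply_eq hζ hζ.pow_eq_one
  have heigen (l : Fin m) :
      σ.toLinearMap (c l • y ^ (l : ℕ)) = ζ ^ (l : ℕ) • c l • y ^ (l : ℕ) := by
    rw [map_smul, AlgEquiv.toLinearMap_apply, map_pow, hσ, _root_.smul_pow, smul_comm]
  have hconj (j : ℕ) : IsIntegral Q.integers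
      ((σ.toLinearMap ^ j) (∑ l, c l • y ^ (l : ℕ))) := by
    induction j with
    | zero => exact hc
    | succ j ih =>
      rw [pow_succ', Module.End.mul_apply]
      exact ih.map (σ.toAlgHom.restrictScalars Q.integers)
  rw [← inv_smul_smul₀ hm (c i • y ^ (i : ℕ)), ← sum_inv_pow_smul_pow_apply_sum hζ heigen]
  exact .smul (⟨_, hminv⟩ : Q.integers) <| .sum _ fun j _ =>
    .smul (⟨_, hcoeff j⟩ : Q.integers) (hconj j)

theorem val_coeff_le_one (hQ : WithZero.exp (-1) ≤ Q.val a) (c : Fin m → F)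
    (hc : IsIntegral Q.integers (∑ i, c i • y ^ (i : ℕ))) (i : Fin m) : Q.val (c i) ≤ 1 := by
  have hint := (h.isIntegral_smul_pow hζ c hc i).pow m
  rw [h.smul_pow_pow, Place.isIntegral_algebraMap_iff_val_le_one, map_mul, map_pow,
    map_pow] at hint
  exact le_one_of_pow_mul_pow_le_one i.2 hQ hint

theorem isIntegralBasis (hQ : WithZero.exp (-1) ≤ Q.val a) (hQ' : Q.val a ≤ 1) :
    Q.IsIntegralBasis fun i : Fin m => y ^ (i : ℕ) := by
  have hy : IsIntegral Q.integers y :=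
    .of_pow h.pos (h.pow_eq ▸ (Place.isIntegral_algebraMap_iff_val_le_one a).2 hQ')
  refine ⟨h.linearIndependent_pow.restrict_scalars' Q.integers, le_antisymm ?_ fun z hz => ?_⟩
  · rw [Submodule.span_le]
    rintro _ ⟨i, rfl⟩
    exact hy.pow _
  · obtain ⟨c, rfl⟩ := h.exists_eq_sum_smul_pow z
    refine Submodule.sum_mem _ fun i _ => ?_
    exact Submodule.smul_mem _ (⟨c i, h.val_coeff_le_one hζ hQ c hz i⟩ : Q.integers)
      (Submodule.subset_span ⟨i, rfl⟩)

end IntegralBasis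

section SplitsCompletely

variable [IsScalarTower k F E]

theorem eq_of_evalEq {ζ : F} (hζ : IsPrimitiveRoot ζ m) (hQ : WithZero.exp (-1) ≤ Q.val a)
    {P' : Place k E} (hP : P.LiesAbove Q) (hP' : P'.LiesAbove Q) {β : k} (hβ : P.EvalEq y β)
    (hβ' : P'.EvalEq y β) : P = P' := by
  have := h.finiteDimensional
  have := h.isGalois hζ
  have := integralClosure.isDedekindDomain Q.integers F E
  have := integralClosure.isFractionRing_of_finite_extension (A := Q.integers) F E
  refine Place.ext <| valuation_eq_of_forall_lt_one_iff (integralClosure Q.integers E)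
    P.surjective_val P'.surjective_val (fun z => hP.val_le_one_of_isIntegral (z := z) z.2)
    (fun z => hP'.val_le_one_of_isIntegral (z := z) z.2) ?_
  rintro ⟨z, hz⟩
  obtain ⟨c, rfl⟩ := h.exists_eq_sum_smul_pow z
  have hc := h.val_coeff_le_one hζ hQ c hz
  exact (hP.val_sum_smul_pow_lt_one_iff hβ hc).trans (hP'.val_sum_smul_pow_lt_one_iff hβ' hc).symm

variable {ω α : k} (hω : IsPrimitiveRoot ω m) (hα : α ≠ 0) (hQ : Q.EvalEq a (α ^ m))
include hω hα hQ

theorem exists_liesAbove_evalEq {β : k} (hβ : β ^ m = α ^ m) :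
    ∃ P : Place k E, P.LiesAbove Q ∧ P.EvalEq y β := by
  have hωF := hω.map_of_injective (algebraMap k F).injective
  have := h.finiteDimensional
  have := h.isGalois hωF
  obtain ⟨P, hP⟩ := Place.exists_liesAbove E Q
  obtain ⟨γ, hγ, hPγ⟩ := hP.exists_evalEq_of_pow_eq h.pos hω h.pow_eq hQ
  have hγ0 : γ ≠ 0 := by
    rintro rfl
    rw [zero_pow h.pos.ne'] at hγ
    exact pow_ne_zero m hα hγ.symm
  obtain ⟨σ, hσ⟩ := h.exists_algEquiv_apply_eq hωF (η := algebraMap k F (β / γ)) (by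
    rw [← map_pow, div_pow, hβ, hγ, div_self (pow_ne_zero m hα), map_one])
  refine ⟨P.conj σ, hP.conj σ, (Place.conj_evalEq_iff σ).2 ?_⟩
  rw [hσ, algebraMap_smul, Algebra.smul_def]
  simpa [hγ0] using hPγ.algebraMap_mul (β / γ)

theorem splitsCompletely : Q.SplitsCompletely E := by
  have hωF := hω.map_of_injective (algebraMap k F).injective
  have hval : WithZero.exp (-1) ≤ Q.val a :=
    hQ.val_eq_one (pow_ne_zero m hα) ▸ (lt_one_iff_le_exp_neg_one.2 le_rfl).le
  choose β hβ hPβ using fun P : {P : Place k E | P.LiesAbove Q} =>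
    P.2.exists_evalEq_of_pow_eq h.pos hω h.pow_eq hQ
  let f (P : {P : Place k E | P.LiesAbove Q}) : {β : k | β ^ m = α ^ m} := ⟨β P, hβ P⟩
  have hinj : Function.Injective f := fun P P' hPP' => by
    have hββ' : β P = β P' := congrArg Subtype.val hPP'
    exact Subtype.ext (h.eq_of_evalEq hωF hval P.2 P'.2 (hPβ P) (hββ' ▸ hPβ P'))
  have hsurj : Function.Surjective f := fun γ => by
    obtain ⟨P, hP, hPγ⟩ := h.exists_liesAbove_evalEq hω hα hQ γ.2
    exact ⟨⟨P, hP⟩, Subtype.ext ((hPβ ⟨P, hP⟩).unique hPγ)⟩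
  rw [Place.SplitsCompletely, h.finrank_eq, ← encard_setOf_pow_eq_pow h.pos hω hα]
  exact Set.encard_congr (Equiv.ofBijective f ⟨hinj, hsurj⟩)

end SplitsCompletely

end IsKummerGenerator

end Kummer

theorem mainTheorem5_general {k : Type*} [Field k] {E : Type*} [Field E]
    [Algebra (RatFunc k) E] [Algebra k E] [IsScalarTower k (RatFunc k) E]
    (m : ℕ) (hm : 0 < m) (ω : kˣ) (hω : IsPrimitiveRoot ω m)
    (u : Polynomial k) (hu : Squarefree u) (hd : Nat.gcd u.natDegree m = 1)
    (y : E) (hy : y ^ m = algebraMap (RatFunc k) E (algebraMap (Polynomial k) (RatFunc k) u))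
    (hE : IntermediateField.adjoin (RatFunc k) {y} = ⊤) :
    (IsGalois (RatFunc k) E ∧ Module.finrank (RatFunc k) E = m ∧
      ∃ φ : (E ≃ₐ[RatFunc k] E) ≃* Subgroup.zpowers ω,
        ∀ σ : E ≃ₐ[RatFunc k] E, σ y = algebraMap k E ((φ σ : kˣ) : k) * y) ∧
    (∃ Qinf : Place k (RatFunc k),
      (∀ Q : Place k (RatFunc k), Q.IsPole RatFunc.X ↔ Q = Qinf) ∧
      Qinf.IsRational ∧
      (∃ Pinf : Place k E,
        (∀ P : Place k E, P.LiesAbove Qinf ↔ P = Pinf) ∧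
        Pinf.HasRamificationIndex Qinf (Module.finrank (RatFunc k) E) ∧
        Pinf.ord (algebraMap (RatFunc k) E RatFunc.X) = ((-(m : ℤ) : ℤ) : WithTop ℤ) ∧
        Pinf.ord y = ((-(u.natDegree : ℤ) : ℤ) : WithTop ℤ)) ∧
      (∀ Q : Place k (RatFunc k), Q ≠ Qinf →
        Q.IsIntegralBasis (fun i : Fin m => y ^ (i : ℕ)))) ∧
    (∀ Q : Place k (RatFunc k),
      (∃ α : k, α ≠ 0 ∧ Q.EvalEq (algebraMap (Polynomial k) (RatFunc k) u) (α ^ m)) →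
      Q.SplitsCompletely E) := by
  have hωk : IsPrimitiveRoot (ω : k) m := IsPrimitiveRoot.coe_units_iff.2 hω
  have hωF := hωk.map_of_injective (algebraMap k (RatFunc k)).injective
  have hval := Place.val_infty_algebraMap hu.ne_zero
  have hv : IsCoprime (WithZero.log ((Place.infty k).val (algebraMap _ _ u))) (m : ℤ) := by
    rw [hval, WithZero.log_exp]
    exact Nat.isCoprime_iff_coprime.2 hd
  have h : IsKummerGenerator m _ y := .of_isCoprime_log hm hy hE _ hv
  have hgalois := h.isGalois hωF
  have := h.finiteDimensional
  obtain ⟨P, hP⟩ := Place.exists_liesAbove E (Place.infty k)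
  have hram := h.hasRamificationIndex hv hP
  refine ⟨⟨hgalois, h.finrank_eq, h.exists_mulEquiv_zpowers hω⟩,
    ⟨Place.infty k, Place.isPole_X_iff, Place.isRational_infty, ⟨P, fun P' =>
      ⟨fun hP' => h.eq_of_liesAbove hv hP' hP, fun hP' => hP' ▸ hP⟩, h.finrank_eq ▸ hram,
      P.ord_eq_neg_of_val_eq_exp ?_, P.ord_eq_neg_of_val_eq_exp ?_⟩, fun Q hQ => ?_⟩,
    fun Q ⟨α, hα, hQ⟩ => h.splitsCompletely hωk hα hQ⟩
  · rw [hram.2, Place.val_infty_X, ← WithZero.exp_nsmul, nsmul_one]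
  · rw [hram.val_eq_of_pow_eq hm.ne' hy, hval]
  · exact h.isIntegralBasis hωF (Place.exp_neg_one_le_val_of_squarefree hQ hu)
      (Place.val_algebraMap_polynomial_le_one hQ u)

theorem mainTheorem5 {Fq : Type*} [Field Fq] [Finite Fq]
    {E : Type*} [Field E] [Algebra (RatFunc Fq) E] [Algebra Fq E]
    [IsScalarTower Fq (RatFunc Fq) E]
    (m : ℕ) (hm : 0 < m) (ω : Fqˣ) (hω : IsPrimitiveRoot ω m)
    (u : Polynomial Fq) (hu : Squarefree u) (hd : Nat.gcd u.natDegree m = 1)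
    (y : E) (hy : y ^ m = algebraMap (RatFunc Fq) E (algebraMap (Polynomial Fq) (RatFunc Fq) u))
    (hE : IntermediateField.adjoin (RatFunc Fq) {y} = ⊤) :
    -- the extension is cyclic of degree `m`
    (IsGalois (RatFunc Fq) E ∧ Module.finrank (RatFunc Fq) E = m ∧
      ∃ φ : (E ≃ₐ[RatFunc Fq] E) ≃* Subgroup.zpowers ω,
        ∀ σ : E ≃ₐ[RatFunc Fq] E, σ y = algebraMap Fq E ((φ σ : Fqˣ) : Fq) * y) ∧
    -- there is a unique pole `Q∞` of `x`, it is rational and totally ramified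
    (∃ Qinf : Place Fq (RatFunc Fq),
      (∀ Q : Place Fq (RatFunc Fq), Q.IsPole RatFunc.X ↔ Q = Qinf) ∧
      Qinf.IsRational ∧
      (∃ Pinf : Place Fq E,
        (∀ P : Place Fq E, P.LiesAbove Qinf ↔ P = Pinf) ∧
        Pinf.HasRamificationIndex Qinf (Module.finrank (RatFunc Fq) E) ∧
        Pinf.ord (algebraMap (RatFunc Fq) E RatFunc.X) = ((-(m : ℤ) : ℤ) : WithTop ℤ) ∧
        Pinf.ord y = ((-(u.natDegree : ℤ) : ℤ) : WithTop ℤ)) ∧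
      -- integral basis at every other place
      (∀ Q : Place Fq (RatFunc Fq), Q ≠ Qinf →
        Q.IsIntegralBasis (fun i : Fin m => y ^ (i : ℕ)))) ∧
    -- complete splitting
    (∀ Q : Place Fq (RatFunc Fq), Q.IsRational →
      (∃ α : Fq, α ≠ 0 ∧ Q.EvalEq (algebraMap (Polynomial Fq) (RatFunc Fq) u) (α ^ m)) →
      Q.SplitsCompletely E) :=
  let ⟨h₁, h₂, h₃⟩ := mainTheorem5_general m hm ω hω u hu hd y hy hE
  ⟨h₁, h₂, fun Q _ => h₃ Q⟩
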